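/- Let $n\ge 1$. Equip $\mathbb C^{n+1}$ with the Hermitian form of signature $(n,1)$ $$\langle Z,W\rangle = Z_0\overline{W_n}+\sum_{i=1}^{n-1}Z_i\overline{W_i}+Z_n\overline{W_0},$$ let $\mathbf H^n_{\mathbb C}\subset\mathbb P(\mathbb C^{n+1})$ be complex hyperbolic space (the set of negative lines) and $S^{2n-1}=\partial\mathbf H^n_{\mathbb C}$ the set of isotropic lines. Let $\Gamma$ be a discrete subgroup of $\mathrm{PU}(n,1)$, let $\Lambda\subset S^{2n-1}$ be its limit set (the set of accumulation points in $S^{2n-1}$ of the $\Gamma$-orbit of a point of $\mathbf H^n_{\mathbb C}$), and let $\Omega=S^{2n-1}\setminus\Lambda$. Identify each $p\in\Lambda$ with the class $\phi_p$ of the linear form $\langle\cdot,\mathbf p\rangle$, whose kernel is the complex hyperplane tangent to the sphere at $p$. For hyperplanes $\phi,\phi'$ (classes of linear forms) and distinct points $\omega,\omega'$ of $\mathbb P(\mathbb C^{n+1})$ not on these hyperplanes, let $[\phi,\phi',\omega,\omega']$ be the cross-ratio $[a,b,\omega,\omega']$ on the projective line $(\omega\omega')$, where $a=\ker\phi\cap(\omega\omega')$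 and $b=\ker\phi'\cap(\omega\omega')$, with the convention $[a,b,c,d]=\frac{(d-b)(c-a)}{(d-a)(c-b)}$; put $[\phi,\phi',\omega,\omega]=1$. (In terms of lifts it equals $\frac{\boldsymbol\phi(\boldsymbol\omega)\boldsymbol\phi'(\boldsymbol\omega')}{\boldsymbol\phi(\boldsymbol\omega')\boldsymbol\phi'(\boldsymbol\omega)}$.) For $\omega,\omega'\in\Omega$ set $$d_\Lambda(\omega,\omega')=\ln\Bigl(\max\bigl\{\,\bigl|[\phi_p,\phi_{p'},\omega,\omega']\bigr| : p,p'\in\Lambda\bigr\}\Bigr).$$ For distinct $p_0,p_1\in\mathbf H^n_{\mathbb C}$ with lifts $v_0,v_1$ such that $\langle v_0,v_0\rangle=\langle v_1,v_1\rangle$, the bisector of $p_0,p_1$, extended to the boundary, is the set of $z\in\mathbf H^n_{\mathbb C}\cup S^{2n-1}$ with $|\langle \mathbf z,v_0\rangle|=|\langle \mathbf z,v_1\rangle|$; its intersection with $S^{2n-1}$ is a spinal sphere. Corollary. If $\Lambda$ is not contained in any bisector (equivalently, in any spinal sphere), then the maximum defining $d_\Lambda(\omega,\omega')$ exists for all $\omega,\omega'\in\Omega$,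 and $d_\Lambda$ is a metric on $\Omega$. -/

import Mathlib

open scoped LinearAlgebra.Projectivization MatrixGroups
open Module (Dual)

namespace GenHilbert

noncomputable section

/-! ### Cross-ratios and the generalized Hilbert metric -/

section CrossRatio

variable {V : Type*} [AddCommGroup V] [Module ℂ V]

/-- The determinant of two vectors of `ℂ²`. -/
def det₂ (u v : Fin 2 → ℂ) : ℂ := u 0 * v 1 - u 1 * v 0

/-- `t` is the cross-ratio `[a, b, c, d] = (d - b)(c - a) / ((d - a)(c - b))` of four points of a
projective line of `ℙ(V)`, computed in some coordinate on that line. The coordinate is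
`z = g₀ / g₁`, where `g = (g₀, g₁) : V → ℂ²` is injective on the plane spanned by the four points,
and the difference `x - y` of the coordinates of two points is written homogeneously as
`det₂ (g x) (g y)` (so that a point may be at infinity). -/
def IsLineCrossRatio (a b c d : ℙ ℂ V) (t : ℂ) : Prop :=
  ∃ g : V →ₗ[ℂ] (Fin 2 → ℂ),
    (∀ v ∈ a.submodule ⊔ b.submodule ⊔ c.submodule ⊔ d.submodule, g v = 0 → v = 0) ∧
    t = (det₂ (g d.rep) (g b.rep) * det₂ (g c.rep) (g a.rep)) /
        (det₂ (g d.rep) (g a.rep) * det₂ (g c.rep) (g b.rep))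

/-- The cross-ratio `[a, b, c, d]` of four points of a projective line of `ℙ(V)`. -/
def lineCrossRatio (a b c d : ℙ ℂ V) : ℂ :=
  Classical.epsilon (IsLineCrossRatio a b c d)

/-- The intersection point `φ_{ω, ω'}` of the hyperplane `ker φ` with the projective line spanned by
the distinct points `ω` and `ω'`. -/
def lineKer (φ : ℙ ℂ (Dual ℂ V)) (ω ω' : ℙ ℂ V) : ℙ ℂ V :=
  @Classical.epsilon _ ⟨ω⟩ fun x : ℙ ℂ V =>
    x.submodule ≤ LinearMap.ker φ.rep ⊓ (ω.submodule ⊔ ω'.submodule)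

open Classical in
/-- The cross-ratio `[φ, φ', ω, ω'] = [φ_{ω, ω'}, φ'_{ω, ω'}, ω, ω']` of two hyperplanes and two
points, with the value `1` when the two points coincide. See `crossRatio_mk` for its expression
`φ(ω) φ'(ω') / (φ(ω') φ'(ω))` through lifts. -/
def crossRatio (φ φ' : ℙ ℂ (Dual ℂ V)) (ω ω' : ℙ ℂ V) : ℂ :=
  if ω = ω' then 1 else lineCrossRatio (lineKer φ ω ω') (lineKer φ' ω ω') ω ω'

/-- The moduli of all the cross-ratios `[φ, φ', ω, ω']`, for `φ` and `φ'` in `Λ`. -/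
def crossRatioModuli (Λ : Set (ℙ ℂ (Dual ℂ V))) (ω ω' : ℙ ℂ V) : Set ℝ :=
  {r | ∃ φ ∈ Λ, ∃ φ' ∈ Λ, r = ‖crossRatio φ φ' ω ω'‖}

/-- The generalized Hilbert (pseudo-)metric
`d_Λ(ω, ω') = ln (max {|[φ, φ', ω, ω']| : φ, φ' ∈ Λ})`. -/
def hilbertDist (Λ : Set (ℙ ℂ (Dual ℂ V))) (ω ω' : ℙ ℂ V) : ℝ :=
  Real.log (sSup (crossRatioModuli Λ ω ω'))

lemma lineKer_spec (φ : ℙ ℂ (Dual ℂ V)) {ω ω' : ℙ ℂ V} (h : ω ≠ ω')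
    (h1 : φ.rep ω.rep ≠ 0) :
    ∃ k : ℂ, k ≠ 0 ∧ (lineKer φ ω ω').rep =
      k • (φ.rep ω'.rep • ω.rep - φ.rep ω.rep • ω'.rep) := by
  have hli : LinearIndependent ℂ ![ω.rep, ω'.rep] :=
    Projectivization.linearIndependent_pair_iff_ne.2 h
  rw [LinearIndependent.pair_iff] at hli
  have hne : φ.rep ω'.rep • ω.rep - φ.rep ω.rep • ω'.rep ≠ 0 := by
    intro h0
    have := hli (φ.rep ω'.rep) (-φ.rep ω.rep) (by rw [← h0]; module)
    exact h1 (by simpa using this.2)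
  have hex : ∃ x : ℙ ℂ V,
      x.submodule ≤ LinearMap.ker φ.rep ⊓ (ω.submodule ⊔ ω'.submodule) := by
    refine ⟨Projectivization.mk ℂ _ hne, ?_⟩
    rw [Projectivization.submodule_mk, Submodule.span_singleton_le_iff_mem, Submodule.mem_inf]
    refine ⟨?_, ?_⟩
    · simp [mul_comm]
    · rw [Projectivization.submodule_eq, Projectivization.submodule_eq]
      exact Submodule.sub_mem _
        (Submodule.mem_sup_left (Submodule.smul_mem _ _ (Submodule.mem_span_singleton_self _)))
        (Submodule.mem_sup_right (Submodule.smul_mem _ _ (Submodule.mem_span_singleton_self _)))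
  have hs := @Classical.epsilon_spec_aux _ ⟨ω⟩ _ hex
  change (lineKer φ ω ω').submodule ≤ _ at hs
  rw [Projectivization.submodule_eq, Submodule.span_singleton_le_iff_mem, Submodule.mem_inf,
    Projectivization.submodule_eq, Projectivization.submodule_eq] at hs
  obtain ⟨hk, hm⟩ := hs
  obtain ⟨y, hy, z, hz, hyz⟩ := Submodule.mem_sup.1 hm
  obtain ⟨s, rfl⟩ := Submodule.mem_span_singleton.1 hy
  obtain ⟨t, rfl⟩ := Submodule.mem_span_singleton.1 hz
  have hst : s * φ.rep ω.rep + t * φ.rep ω'.rep = 0 := by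
    have : φ.rep (lineKer φ ω ω').rep = 0 := hk
    rw [← hyz] at this
    simpa using this
  have heq : (lineKer φ ω ω').rep =
      (-t / φ.rep ω.rep) • (φ.rep ω'.rep • ω.rep - φ.rep ω.rep • ω'.rep) := by
    have hs' : s = (-t / φ.rep ω.rep) * φ.rep ω'.rep := by
      field_simp
      linear_combination hst
    have ht' : t = -((-t / φ.rep ω.rep) * φ.rep ω.rep) := by
      field_simp
    rw [← hyz, smul_sub, smul_smul, smul_smul, ← hs']
    nth_rewrite 1 [ht']
    module
  refine ⟨_, ?_, heq⟩
  intro h0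
  rw [h0, zero_smul] at heq
  exact (lineKer φ ω ω').rep_nonzero heq

lemma crossRatio_rep (φ φ' : ℙ ℂ (Dual ℂ V)) (ω ω' : ℙ ℂ V)
    (h1 : φ.rep ω.rep ≠ 0) (h2 : φ.rep ω'.rep ≠ 0)
    (h3 : φ'.rep ω.rep ≠ 0) (h4 : φ'.rep ω'.rep ≠ 0) :
    crossRatio φ φ' ω ω' =
      (φ.rep ω.rep * φ'.rep ω'.rep) / (φ.rep ω'.rep * φ'.rep ω.rep) := by
  unfold crossRatio
  split_ifs with h
  · subst h
    field_simp
  obtain ⟨k, hk0, hk⟩ := lineKer_spec φ h h1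
  obtain ⟨k', hk0', hk'⟩ := lineKer_spec φ' h h3
  have hli : LinearIndependent ℂ ![ω.rep, ω'.rep] :=
    Projectivization.linearIndependent_pair_iff_ne.2 h
  have hli' := LinearIndependent.pair_iff.1 hli
  -- every admissible coordinate gives the claimed value
  have huniq : ∀ t, IsLineCrossRatio (lineKer φ ω ω') (lineKer φ' ω ω') ω ω' t →
      t = (φ.rep ω.rep * φ'.rep ω'.rep) / (φ.rep ω'.rep * φ'.rep ω.rep) := by
    rintro t ⟨g, hg, rfl⟩
    have hmem : ∀ p q : ℂ, p • ω.rep + q • ω'.rep ∈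
        (lineKer φ ω ω').submodule ⊔ (lineKer φ' ω ω').submodule ⊔ ω.submodule ⊔
          ω'.submodule := by
      intro p q
      rw [Projectivization.submodule_eq ω, Projectivization.submodule_eq ω']
      exact Submodule.add_mem _
        (Submodule.mem_sup_left (Submodule.mem_sup_right
          (Submodule.smul_mem _ _ (Submodule.mem_span_singleton_self _))))
        (Submodule.mem_sup_right (Submodule.smul_mem _ _ (Submodule.mem_span_singleton_self _)))
    have hdet : det₂ (g ω.rep) (g ω'.rep) ≠ 0 := by
      intro h0
      have key : ∀ i : Fin 2, g ω'.rep i = 0 ∧ g ω.rep i = 0 := by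
        intro i
        have hz : (g ω'.rep i) • ω.rep + (-(g ω.rep i)) • ω'.rep = 0 := by
          apply hg _ (hmem _ _)
          funext j
          simp only [det₂] at h0
          simp only [map_add, map_smul, Pi.add_apply, Pi.smul_apply, smul_eq_mul, Pi.zero_apply]
          fin_cases i <;> fin_cases j <;> simp only [Fin.zero_eta, Fin.mk_one]
          · ring
          · linear_combination -h0
          · linear_combination h0
          · ring
        have := hli' _ _ hz
        exact ⟨this.1, by simpa using this.2⟩
      refine ω.rep_nonzero (hg _ (by simpa using hmem 1 0) (funext fun i => (key i).2))
    rw [hk, hk']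
    have e1 : det₂ (g ω'.rep) (g (k' • (φ'.rep ω'.rep • ω.rep - φ'.rep ω.rep • ω'.rep))) =
        -(k' * φ'.rep ω'.rep * det₂ (g ω.rep) (g ω'.rep)) := by
      simp only [det₂, map_sub, map_smul, Pi.sub_apply, Pi.smul_apply, smul_eq_mul]; ring
    have e2 : det₂ (g ω.rep) (g (k • (φ.rep ω'.rep • ω.rep - φ.rep ω.rep • ω'.rep))) =
        -(k * φ.rep ω.rep * det₂ (g ω.rep) (g ω'.rep)) := by
      simp only [det₂, map_sub, map_smul, Pi.sub_apply, Pi.smul_apply, smul_eq_mul]; ring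
    have e3 : det₂ (g ω'.rep) (g (k • (φ.rep ω'.rep • ω.rep - φ.rep ω.rep • ω'.rep))) =
        -(k * φ.rep ω'.rep * det₂ (g ω.rep) (g ω'.rep)) := by
      simp only [det₂, map_sub, map_smul, Pi.sub_apply, Pi.smul_apply, smul_eq_mul]; ring
    have e4 : det₂ (g ω.rep) (g (k' • (φ'.rep ω'.rep • ω.rep - φ'.rep ω.rep • ω'.rep))) =
        -(k' * φ'.rep ω.rep * det₂ (g ω.rep) (g ω'.rep)) := by
      simp only [det₂, map_sub, map_smul, Pi.sub_apply, Pi.smul_apply, smul_eq_mul]; ring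
    rw [e1, e2, e3, e4]
    field_simp
  -- an admissible coordinate exists
  have hex : ∃ t, IsLineCrossRatio (lineKer φ ω ω') (lineKer φ' ω ω') ω ω' t := by
    obtain ⟨g, hg⟩ := LinearMap.exists_leftInverse_of_injective
      (Fintype.linearCombination ℂ ![ω.rep, ω'.rep])
      (LinearMap.ker_eq_bot.2 (hli.fintypeLinearCombination_injective))
    refine ⟨_, g, ?_, rfl⟩
    intro v hv hv0
    have hle : (lineKer φ ω ω').submodule ⊔ (lineKer φ' ω ω').submodule ⊔ ω.submodule ⊔
          ω'.submodule ≤ LinearMap.range (Fintype.linearCombination ℂ ![ω.rep, ω'.rep]) := by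
      have hr : ∀ p q : ℂ, p • ω.rep + q • ω'.rep ∈
          LinearMap.range (Fintype.linearCombination ℂ ![ω.rep, ω'.rep]) := fun p q =>
        ⟨![p, q], by simp [Fintype.linearCombination_apply]⟩
      simp only [sup_le_iff, Projectivization.submodule_eq, Submodule.span_singleton_le_iff_mem]
      refine ⟨⟨⟨?_, ?_⟩, by simpa using hr 1 0⟩, by simpa using hr 0 1⟩
      · rw [hk]
        convert hr (k * φ.rep ω'.rep) (-(k * φ.rep ω.rep)) using 1
        module
      · rw [hk']
        convert hr (k' * φ'.rep ω'.rep) (-(k' * φ'.rep ω.rep)) using 1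
        module
    obtain ⟨u, rfl⟩ := hle hv
    have hu : g (Fintype.linearCombination ℂ ![ω.rep, ω'.rep] u) = u :=
      LinearMap.congr_fun hg u
    rw [hu] at hv0
    rw [hv0, map_zero]
  exact huniq _ (Classical.epsilon_spec hex)

/-- The cross-ratio in terms of lifts. -/
theorem crossRatio_mk (f f' : Dual ℂ V) (v v' : V) (hf : f ≠ 0) (hf' : f' ≠ 0)
    (hv : v ≠ 0) (hv' : v' ≠ 0)
    (h1 : f v ≠ 0) (h2 : f v' ≠ 0) (h3 : f' v ≠ 0) (h4 : f' v' ≠ 0) :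
    crossRatio (Projectivization.mk ℂ f hf) (Projectivization.mk ℂ f' hf')
      (Projectivization.mk ℂ v hv) (Projectivization.mk ℂ v' hv') =
      (f v * f' v') / (f v' * f' v) := by
  obtain ⟨a, ha⟩ := Projectivization.exists_smul_eq_mk_rep ℂ f hf
  obtain ⟨a', ha'⟩ := Projectivization.exists_smul_eq_mk_rep ℂ f' hf'
  obtain ⟨b, hb⟩ := Projectivization.exists_smul_eq_mk_rep ℂ v hv
  obtain ⟨b', hb'⟩ := Projectivization.exists_smul_eq_mk_rep ℂ v' hv'
  have ha0 := a.ne_zero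
  have ha0' := a'.ne_zero
  have hb0 := b.ne_zero
  have hb0' := b'.ne_zero
  rw [crossRatio_rep] <;>
    simp only [← ha, ← ha', ← hb, ← hb', Units.smul_def, LinearMap.smul_apply, map_smul,
      smul_eq_mul]
  · field_simp
  all_goals positivity

end CrossRatio

/-! ### Topology on projective spaces and on the projective linear group -/

/-- The quotient topology on the projective space of a topological vector space. -/
instance instTopologicalSpaceProjectivization {V : Type*} [AddCommGroup V] [Module ℂ V]
    [TopologicalSpace V] : TopologicalSpace (ℙ ℂ V) :=
  TopologicalSpace.coinduced (Projectivization.mk' ℂ (V := V)) inferInstance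

/-- The quotient topology on the projective linear group `PGL(m, ℂ)`. -/
instance instTopologicalSpacePGL (m : ℕ) : TopologicalSpace PGL(Fin m, ℂ) :=
  TopologicalSpace.coinduced (Matrix.ProjGenLinGroup.mk (n := Fin m) (R := ℂ)) inferInstance

/-! ### Complex hyperbolic geometry -/

/-- The Hermitian form `⟨Z, W⟩ = Z₀ W̄ₙ + Z₁ W̄₁ + ⋯ + Zₙ₋₁ W̄ₙ₋₁ + Zₙ W̄₀` on `ℂⁿ⁺¹`, of signature
`(n, 1)` for `n ≥ 1`. It is linear in `Z` and conjugate-linear in `W`. -/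
def herm {n : ℕ} (Z W : Fin (n + 1) → ℂ) : ℂ :=
  ∑ i, Z i * star (W (Equiv.swap 0 (Fin.last n) i))

/-- The linear form `⟨·, W⟩`. -/
def hermForm {n : ℕ} (W : Fin (n + 1) → ℂ) : Dual ℂ (Fin (n + 1) → ℂ) where
  toFun Z := herm Z W
  map_add' Z Z' := by simp [herm, add_mul, Finset.sum_add_distrib]
  map_smul' c Z := by simp [herm, mul_assoc, Finset.mul_sum]

lemma hermForm_ne_zero {n : ℕ} {W : Fin (n + 1) → ℂ} (hW : W ≠ 0) : hermForm W ≠ 0 := by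
  intro h
  apply hW
  funext j
  have := LinearMap.congr_fun h (Pi.single (Equiv.swap 0 (Fin.last n) j) 1)
  simpa [hermForm, herm, Pi.single_apply] using this

/-- Complex hyperbolic space `H^n_ℂ`: the set of negative lines. -/
def hypSpace (n : ℕ) : Set (ℙ ℂ (Fin (n + 1) → ℂ)) := {p | (herm p.rep p.rep).re < 0}

/-- The sphere at infinity `S^{2n-1} = ∂H^n_ℂ`: the set of isotropic lines. -/
def sphere (n : ℕ) : Set (ℙ ℂ (Fin (n + 1) → ℂ)) := {p | herm p.rep p.rep = 0}

/-- The point of the dual projective space defined by the linear form `⟨·, p⟩`. When `p` is in the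
sphere at infinity, its kernel is the complex hyperplane tangent to the sphere at `p`. -/
def polar {n : ℕ} (p : ℙ ℂ (Fin (n + 1) → ℂ)) : ℙ ℂ (Dual ℂ (Fin (n + 1) → ℂ)) :=
  Projectivization.mk ℂ (hermForm p.rep) (hermForm_ne_zero p.rep_nonzero)

/-- The bisector of two points `p₀, p₁` of complex hyperbolic space, extended to the sphere at
infinity: the points `z` with `|⟨z, v₀⟩| = |⟨z, v₁⟩|`, where `v₀, v₁` are lifts of `p₀, p₁` such that
`⟨v₀, v₀⟩ = ⟨v₁, v₁⟩`. Inside `H^n_ℂ` these are the points equidistant from `p₀` and `p₁`; the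
points on the sphere at infinity form the corresponding spinal sphere. -/
def bisector {n : ℕ} (p₀ p₁ : ℙ ℂ (Fin (n + 1) → ℂ)) : Set (ℙ ℂ (Fin (n + 1) → ℂ)) :=
  {z | z ∈ hypSpace n ∪ sphere n ∧
    ∃ (v₀ v₁ : Fin (n + 1) → ℂ) (h₀ : v₀ ≠ 0) (h₁ : v₁ ≠ 0),
      Projectivization.mk ℂ v₀ h₀ = p₀ ∧ Projectivization.mk ℂ v₁ h₁ = p₁ ∧
      herm v₀ v₀ = herm v₁ v₁ ∧ ‖herm z.rep v₀‖ = ‖herm z.rep v₁‖}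

/-- The unitary group `U(n, 1)` of the Hermitian form. -/
def unitaryN1 (n : ℕ) : Subgroup (GL (Fin (n + 1)) ℂ) where
  carrier := {g | ∀ Z W : Fin (n + 1) → ℂ, herm (g.1.mulVec Z) (g.1.mulVec W) = herm Z W}
  one_mem' := by intro Z W; simp
  mul_mem' {g h} hg hh := by
    intro Z W
    have := hg (h.1.mulVec Z) (h.1.mulVec W)
    simpa [Matrix.mulVec_mulVec] using this.trans (hh Z W)
  inv_mem' {g} hg := by
    intro Z W
    have := hg ((g⁻¹).1.mulVec Z) ((g⁻¹).1.mulVec W)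
    rw [Matrix.mulVec_mulVec, Matrix.mulVec_mulVec, ← Units.val_mul, mul_inv_cancel] at this
    simpa using this.symm

/-- The projective unitary group `PU(n, 1)`, as a subgroup of `PGL(n + 1, ℂ)`. -/
def PU (n : ℕ) : Subgroup PGL(Fin (n + 1), ℂ) :=
  (unitaryN1 n).map Matrix.ProjGenLinGroup.mk

/-- The limit set of a subgroup `Γ` of `PU(n, 1)`: the points of the sphere at infinity that are
accumulation points of the orbit `Γ x` of a point `x` of complex hyperbolic space. It does not
depend on the choice of `x`. -/
def limitSet {n : ℕ} (Γ : Subgroup PGL(Fin (n + 1), ℂ)) (x : ℙ ℂ (Fin (n + 1) → ℂ)) :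
    Set (ℙ ℂ (Fin (n + 1) → ℂ)) :=
  sphere n ∩ closure (MulAction.orbit Γ x)

end

end GenHilbert

/-!
Through lifts, `[φ, φ', ω, ω'] = φ(ω) φ'(ω') / (φ(ω') φ'(ω))` is multiplicative along chains
`ω, ω', ω''`, so the logarithm of its maximal modulus satisfies the triangle inequality; it is
attained because the closed set `Λ` is compact. If all the moduli are `1` for some `ω ≠ ω'`, then
`|⟨p, ω⟩| / |⟨p, ω'⟩|` takes a constant value on `Λ`. Rescaling the lift of `ω'`, we may suppose
that this value is `1` and that `⟨ω, ω'⟩` is negative; then `2ω + ω'` and `ω + 2ω'` are negative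
vectors of the same norm, and each `p ∈ Λ` is in their bisector.
-/

open scoped Pointwise

namespace GenHilbert

section CrossRatioAlgebra

variable {V : Type*} [AddCommGroup V] [Module ℂ V] {Λ : Set (ℙ ℂ (Dual ℂ V))}
  {φ φ' : ℙ ℂ (Dual ℂ V)} {ω ω' ω'' : ℙ ℂ V}

/-- The complement in `ℙ(V)` of the union of the hyperplanes that belong to `Λ`: the largest set on
which the cross-ratios with hyperplanes in `Λ` are all finite and nonzero. -/
def hyperplaneCompl (Λ : Set (ℙ ℂ (Dual ℂ V))) : Set (ℙ ℂ V) :=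
  {ω | ∀ φ ∈ Λ, φ.rep ω.rep ≠ 0}

lemma crossRatio_self_right (φ φ' : ℙ ℂ (Dual ℂ V)) (ω : ℙ ℂ V) : crossRatio φ φ' ω ω = 1 :=
  if_pos rfl

lemma crossRatio_self_left (hφ : φ ∈ Λ) (hω : ω ∈ hyperplaneCompl Λ)
    (hω' : ω' ∈ hyperplaneCompl Λ) : crossRatio φ φ ω ω' = 1 := by
  have h := hω φ hφ
  have h' := hω' φ hφ
  rw [crossRatio_rep φ φ ω ω' h h' h h', mul_comm, div_self (mul_ne_zero h' h)]

lemma crossRatio_swap (hφ : φ ∈ Λ) (hφ' : φ' ∈ Λ) (hω : ω ∈ hyperplaneCompl Λ)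
    (hω' : ω' ∈ hyperplaneCompl Λ) : crossRatio φ' φ ω' ω = crossRatio φ φ' ω ω' := by
  rw [crossRatio_rep φ' φ ω' ω (hω' φ' hφ') (hω φ' hφ') (hω' φ hφ) (hω φ hφ),
    crossRatio_rep φ φ' ω ω' (hω φ hφ) (hω' φ hφ) (hω φ' hφ') (hω' φ' hφ')]
  ring

lemma crossRatio_mul_crossRatio (hφ : φ ∈ Λ) (hφ' : φ' ∈ Λ) (hω : ω ∈ hyperplaneCompl Λ)
    (hω' : ω' ∈ hyperplaneCompl Λ) (hω'' : ω'' ∈ hyperplaneCompl Λ) :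
    crossRatio φ φ' ω ω' * crossRatio φ φ' ω' ω'' = crossRatio φ φ' ω ω'' := by
  have h := hω' φ hφ
  have h' := hω' φ' hφ'
  rw [crossRatio_rep φ φ' ω ω' (hω φ hφ) h (hω φ' hφ') h',
    crossRatio_rep φ φ' ω' ω'' h (hω'' φ hφ) h' (hω'' φ' hφ'),
    crossRatio_rep φ φ' ω ω'' (hω φ hφ) (hω'' φ hφ) (hω φ' hφ') (hω'' φ' hφ')]
  field_simp

lemma crossRatioModuli_comm (hω : ω ∈ hyperplaneCompl Λ) (hω' : ω' ∈ hyperplaneCompl Λ) :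
    crossRatioModuli Λ ω ω' = crossRatioModuli Λ ω' ω := by
  ext r
  constructor <;> rintro ⟨φ, hφ, φ', hφ', rfl⟩
  · exact ⟨φ', hφ', φ, hφ, by rw [crossRatio_swap hφ hφ' hω hω']⟩
  · exact ⟨φ', hφ', φ, hφ, by rw [crossRatio_swap hφ hφ' hω' hω]⟩

lemma one_mem_crossRatioModuli (hΛ : Λ.Nonempty) (hω : ω ∈ hyperplaneCompl Λ)
    (hω' : ω' ∈ hyperplaneCompl Λ) : 1 ∈ crossRatioModuli Λ ω ω' := by
  obtain ⟨φ, hφ⟩ := hΛ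
  exact ⟨φ, hφ, φ, hφ, by rw [crossRatio_self_left hφ hω hω', norm_one]⟩

lemma sSup_crossRatioModuli_pos (hΛ : Λ.Nonempty) (hω : ω ∈ hyperplaneCompl Λ)
    (hω' : ω' ∈ hyperplaneCompl Λ) (hbdd : BddAbove (crossRatioModuli Λ ω ω')) :
    0 < sSup (crossRatioModuli Λ ω ω') :=
  one_pos.trans_le (le_csSup hbdd (one_mem_crossRatioModuli hΛ hω hω'))

lemma hilbertDist_self (Λ : Set (ℙ ℂ (Dual ℂ V))) (ω : ℙ ℂ V) : hilbertDist Λ ω ω = 0 := by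
  have hsub : crossRatioModuli Λ ω ω ⊆ {1} := by
    rintro _ ⟨φ, -, φ', -, rfl⟩
    simp [crossRatio_self_right]
  rcases Set.subset_singleton_iff_eq.1 hsub with h | h <;> simp [hilbertDist, h]

lemma hilbertDist_comm (hω : ω ∈ hyperplaneCompl Λ) (hω' : ω' ∈ hyperplaneCompl Λ) :
    hilbertDist Λ ω ω' = hilbertDist Λ ω' ω := by
  rw [hilbertDist, hilbertDist, crossRatioModuli_comm hω hω']

lemma hilbertDist_triangle (hΛ : Λ.Nonempty) (hω : ω ∈ hyperplaneCompl Λ)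
    (hω' : ω' ∈ hyperplaneCompl Λ) (hω'' : ω'' ∈ hyperplaneCompl Λ)
    (hbdd : ∀ η ∈ hyperplaneCompl Λ, ∀ η' ∈ hyperplaneCompl Λ, BddAbove (crossRatioModuli Λ η η')) :
    hilbertDist Λ ω ω'' ≤ hilbertDist Λ ω ω' + hilbertDist Λ ω' ω'' := by
  have hpos {η η' : ℙ ℂ V} (hη : η ∈ hyperplaneCompl Λ) (hη' : η' ∈ hyperplaneCompl Λ) :=
    sSup_crossRatioModuli_pos hΛ hη hη' (hbdd η hη η' hη')
  unfold hilbertDist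
  rw [← Real.log_mul (hpos hω hω').ne' (hpos hω' hω'').ne']
  refine Real.log_le_log (hpos hω hω'') (csSup_le ⟨1, one_mem_crossRatioModuli hΛ hω hω''⟩ ?_)
  rintro _ ⟨φ, hφ, φ', hφ', rfl⟩
  rw [← crossRatio_mul_crossRatio hφ hφ' hω hω' hω'', norm_mul]
  gcongr
  · exact (hpos hω hω').le
  · exact le_csSup (hbdd ω hω ω' hω') ⟨φ, hφ, φ', hφ', rfl⟩
  · exact le_csSup (hbdd ω' hω' ω'' hω'') ⟨φ, hφ, φ', hφ', rfl⟩

lemma norm_crossRatio_eq_one_of_hilbertDist_eq_zero (hω : ω ∈ hyperplaneCompl Λ)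
    (hω' : ω' ∈ hyperplaneCompl Λ) (hbdd : BddAbove (crossRatioModuli Λ ω ω'))
    (h : hilbertDist Λ ω ω' = 0) (hφ : φ ∈ Λ) (hφ' : φ' ∈ Λ) :
    ‖crossRatio φ φ' ω ω'‖ = 1 := by
  have hpos := sSup_crossRatioModuli_pos ⟨φ, hφ⟩ hω hω' hbdd
  have hsup : sSup (crossRatioModuli Λ ω ω') = 1 := Real.eq_one_of_pos_of_log_eq_zero hpos h
  have hle {ψ ψ' : ℙ ℂ (Dual ℂ V)} (hψ : ψ ∈ Λ) (hψ' : ψ' ∈ Λ) : ‖crossRatio ψ ψ' ω ω'‖ ≤ 1 :=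
    hsup ▸ le_csSup hbdd ⟨ψ, hψ, ψ', hψ', rfl⟩
  have hinv : ‖crossRatio φ φ' ω ω'‖ * ‖crossRatio φ' φ ω ω'‖ = 1 := by
    rw [← crossRatio_swap hφ' hφ hω hω', ← norm_mul,
      crossRatio_mul_crossRatio hφ hφ' hω hω' hω, crossRatio_self_right, norm_one]
  refine (hle hφ hφ').antisymm ?_
  calc (1 : ℝ) = ‖crossRatio φ φ' ω ω'‖ * ‖crossRatio φ' φ ω ω'‖ := hinv.symm
    _ ≤ ‖crossRatio φ φ' ω ω'‖ := mul_le_of_le_one_right (norm_nonneg _) (hle hφ' hφ)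

/-- The generalized Hilbert metric on a set of points off the hyperplanes in `Λ`, when the moduli of
the cross-ratios are bounded and separate these points. -/
noncomputable abbrev hilbertMetricSpace (Λ : Set (ℙ ℂ (Dual ℂ V))) (Ω : Set (ℙ ℂ V))
    (hΛ : Λ.Nonempty) (hΩ : Ω ⊆ hyperplaneCompl Λ)
    (hbdd : ∀ ω ∈ hyperplaneCompl Λ, ∀ ω' ∈ hyperplaneCompl Λ, BddAbove (crossRatioModuli Λ ω ω'))
    (hsep : ∀ ω ∈ Ω, ∀ ω' ∈ Ω, (∀ φ ∈ Λ, ∀ φ' ∈ Λ, ‖crossRatio φ φ' ω ω'‖ = 1) → ω = ω') :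
    MetricSpace Ω where
  dist ω ω' := hilbertDist Λ ω ω'
  dist_self ω := hilbertDist_self Λ ω
  dist_comm ω ω' := hilbertDist_comm (hΩ ω.2) (hΩ ω'.2)
  dist_triangle ω ω' ω'' := hilbertDist_triangle hΛ (hΩ ω.2) (hΩ ω'.2) (hΩ ω''.2) hbdd
  eq_of_dist_eq_zero {ω ω'} h := Subtype.ext <| hsep ω ω.2 ω' ω'.2 fun _ hφ _ hφ' =>
    norm_crossRatio_eq_one_of_hilbertDist_eq_zero (hΩ ω.2) (hΩ ω'.2)
      (hbdd ω (hΩ ω.2) ω' (hΩ ω'.2)) h hφ hφ'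

end CrossRatioAlgebra

section ProjectiveTopology

lemma isQuotientMap_mk' {V : Type*} [AddCommGroup V] [Module ℂ V] [TopologicalSpace V] :
    Topology.IsQuotientMap (Projectivization.mk' ℂ (V := V)) where
  eq_coinduced := rfl
  surjective p := ⟨⟨p.rep, p.rep_nonzero⟩, p.mk_rep⟩

lemma continuousOn_div_rep {V : Type*} [AddCommGroup V] [Module ℂ V] [TopologicalSpace V]
    {f g : Dual ℂ V} (hf : Continuous f) (hg : Continuous g) :
    ContinuousOn (fun p : ℙ ℂ V => f p.rep / g p.rep) {p | g p.rep ≠ 0} := by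
  have hpre : Projectivization.mk' ℂ ⁻¹' {p : ℙ ℂ V | g p.rep ≠ 0} = {v | g v.1 ≠ 0} := by
    ext v
    obtain ⟨c, hc⟩ := Projectivization.exists_smul_eq_mk_rep ℂ v.1 v.2
    simp [← hc, Units.smul_def]
  have hopen : IsOpen {v : {v : V // v ≠ 0} | g v.1 ≠ 0} :=
    isOpen_ne_fun (hg.comp continuous_subtype_val) continuous_const
  rw [isQuotientMap_mk'.continuousOn_isOpen_iff
    (isQuotientMap_mk'.isOpen_preimage.1 (hpre ▸ hopen)), hpre]
  refine ((hf.comp continuous_subtype_val).continuousOn.div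
    (hg.comp continuous_subtype_val).continuousOn fun v hv => hv).congr fun v _ => ?_
  obtain ⟨c, hc⟩ := Projectivization.exists_smul_eq_mk_rep ℂ v.1 v.2
  simp [← hc, Units.smul_def, mul_div_mul_left]

instance {V : Type*} [NormedAddCommGroup V] [NormedSpace ℂ V] [ProperSpace V] :
    CompactSpace (ℙ ℂ V) := by
  let toProj (v : Metric.sphere (0 : V) 1) : ℙ ℂ V :=
    Projectivization.mk' ℂ ⟨v.1, ne_zero_of_mem_unit_sphere v⟩
  have hcont : Continuous toProj :=
    isQuotientMap_mk'.continuous.comp (continuous_subtype_val.subtype_mk _)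
  have hsurj : Function.Surjective toProj := by
    intro p
    refine ⟨⟨(‖p.rep‖ : ℂ)⁻¹ • p.rep, by simp [norm_smul, p.rep_nonzero]⟩, ?_⟩
    conv_rhs => rw [← p.mk_rep]
    exact (Projectivization.mk_eq_mk_iff' ℂ _ _ _ _).2 ⟨_, rfl⟩
  have : CompactSpace (Metric.sphere (0 : V) 1) :=
    isCompact_iff_compactSpace.1 (isCompact_sphere 0 1)
  exact hsurj.compactSpace hcont

end ProjectiveTopology

section HermitianForm

variable {n : ℕ}

lemma herm_add_left (u v w : Fin (n + 1) → ℂ) : herm (u + v) w = herm u w + herm v w :=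
  (hermForm w).map_add u v

lemma herm_smul_left (c : ℂ) (u w : Fin (n + 1) → ℂ) : herm (c • u) w = c * herm u w :=
  (hermForm w).map_smul c u

lemma star_herm (u w : Fin (n + 1) → ℂ) : star (herm u w) = herm w u := by
  unfold herm
  rw [star_sum, ← Equiv.sum_comp (Equiv.swap 0 (Fin.last n))]
  simp [mul_comm]

lemma herm_add_right (u v w : Fin (n + 1) → ℂ) : herm u (v + w) = herm u v + herm u w := by
  rw [← star_herm, herm_add_left, star_add, star_herm, star_herm]

lemma herm_smul_right (c : ℂ) (u w : Fin (n + 1) → ℂ) : herm u (c • w) = star c * herm u w := by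
  rw [← star_herm, herm_smul_left, star_mul', star_herm]

lemma herm_smul_self (c : ℂ) (u : Fin (n + 1) → ℂ) :
    herm (c • u) (c • u) = Complex.normSq c * herm u u := by
  rw [herm_smul_left, herm_smul_right, ← mul_assoc, Complex.star_def, Complex.mul_conj]

lemma norm_herm_comm (u w : Fin (n + 1) → ℂ) : ‖herm u w‖ = ‖herm w u‖ := by
  rw [← star_herm, norm_star]

lemma herm_ne_zero_comm {u w : Fin (n + 1) → ℂ} : herm u w ≠ 0 ↔ herm w u ≠ 0 := by
  rw [← star_herm, star_ne_zero]

lemma continuous_herm_self : Continuous fun w : Fin (n + 1) → ℂ => herm w w := by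
  unfold herm
  fun_prop

lemma herm_single_right (u : Fin (n + 1) → ℂ) (i : Fin (n + 1)) (c : ℂ) :
    herm u (Pi.single i c) = u (Equiv.swap 0 (Fin.last n) i) * star c := by
  unfold herm
  rw [← Equiv.sum_comp (Equiv.swap 0 (Fin.last n))]
  simp [Pi.single_apply, apply_ite]

lemma herm_self_eq_sum_norm_sq {u : Fin (n + 1) → ℂ} (h0 : u 0 = 0) :
    herm u u = ((∑ i ∈ Finset.univ.erase (Fin.last n), ‖u i‖ ^ 2 : ℝ) : ℂ) := by
  unfold herm
  rw [← Finset.add_sum_erase _ _ (Finset.mem_univ (Fin.last n)), Equiv.swap_apply_right, h0,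
    star_zero, mul_zero, zero_add, Complex.ofReal_sum]
  refine Finset.sum_congr rfl fun i hi => ?_
  by_cases hi0 : i = 0
  · simp [hi0, h0]
  · rw [Equiv.swap_apply_of_ne_of_ne hi0 (Finset.ne_of_mem_erase hi), Complex.star_def,
      Complex.mul_conj', Complex.ofReal_pow]

lemma eq_single_last_of_isotropic {u : Fin (n + 1) → ℂ} (hu : herm u u = 0) (h0 : u 0 = 0) :
    u = Pi.single (Fin.last n) (u (Fin.last n)) := by
  rw [herm_self_eq_sum_norm_sq h0, Complex.ofReal_eq_zero,
    Finset.sum_eq_zero_iff_of_nonneg fun _ _ => by positivity] at hu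
  funext i
  by_cases hi : i = Fin.last n
  · subst hi
    rw [Pi.single_eq_same]
  · simpa [Pi.single_eq_of_ne hi] using hu i (Finset.mem_erase.2 ⟨hi, Finset.mem_univ i⟩)

lemma smul_eq_smul_of_isotropic_of_herm_eq_zero {u w : Fin (n + 1) → ℂ} (hu : herm u u = 0)
    (hw : herm w w = 0) (huw : herm u w = 0) : w 0 • u = u 0 • w := by
  have hwu : herm w u = 0 := by rw [← star_herm, huw, star_zero]
  set z := w 0 • u + (-u 0) • w with hz
  have hz_last : z = Pi.single (Fin.last n) (z (Fin.last n)) := by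
    apply eq_single_last_of_isotropic
    · simp only [hz, herm_add_left, herm_add_right, herm_smul_left, herm_smul_right, hu, hw, huw,
        hwu, mul_zero, add_zero]
    · simp [hz, mul_comm]
  have huz : u 0 * star (z (Fin.last n)) = 0 := by
    rw [← Equiv.swap_apply_right 0 (Fin.last n), ← herm_single_right, ← hz_last, hz]
    simp only [herm_add_right, herm_smul_right, hu, huw, mul_zero, add_zero]
  have hwz : w 0 * star (z (Fin.last n)) = 0 := by
    rw [← Equiv.swap_apply_right 0 (Fin.last n), ← herm_single_right, ← hz_last, hz]
    simp only [herm_add_right, herm_smul_right, hw, hwu, mul_zero, add_zero]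
  by_cases hc : z (Fin.last n) = 0
  · rw [hc, Pi.single_zero, hz, neg_smul, ← sub_eq_add_neg, sub_eq_zero] at hz_last
    exact hz_last
  · have hc' : star (z (Fin.last n)) ≠ 0 := star_ne_zero.2 hc
    rw [(mul_eq_zero_iff_right hc').1 huz, (mul_eq_zero_iff_right hc').1 hwz, zero_smul, zero_smul]

lemma herm_ne_zero_of_linearIndependent {u w : Fin (n + 1) → ℂ} (hu : herm u u = 0)
    (hw : herm w w = 0) (hli : LinearIndependent ℂ ![u, w]) : herm u w ≠ 0 := by
  intro huw
  rw [LinearIndependent.pair_iff] at hli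
  have h0 := hli (w 0) (-u 0) (by
    rw [smul_eq_smul_of_isotropic_of_herm_eq_zero hu hw huw, neg_smul, add_neg_cancel])
  have hu_last := eq_single_last_of_isotropic hu (neg_eq_zero.1 h0.2)
  have hw_last := eq_single_last_of_isotropic hw h0.1
  have hlast := hli (w (Fin.last n)) (-u (Fin.last n)) (by
    rw [hu_last, hw_last, ← Pi.single_smul, ← Pi.single_smul, ← Pi.single_add]
    simp [mul_comm])
  have hu0 : u = 0 := by rw [hu_last, neg_eq_zero.1 hlast.2, Pi.single_zero]
  simpa using hli 1 0 (by simp [hu0])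

end HermitianForm

section HyperbolicSpace

variable {n : ℕ}

lemma mk_mem_sphere_iff {v : Fin (n + 1) → ℂ} (hv : v ≠ 0) :
    Projectivization.mk ℂ v hv ∈ sphere n ↔ herm v v = 0 := by
  obtain ⟨c, hc⟩ := Projectivization.exists_smul_eq_mk_rep ℂ v hv
  simp [sphere, ← hc, Units.smul_def, herm_smul_self]

lemma mk_mem_hypSpace_iff {v : Fin (n + 1) → ℂ} (hv : v ≠ 0) :
    Projectivization.mk ℂ v hv ∈ hypSpace n ↔ (herm v v).re < 0 := by
  obtain ⟨c, hc⟩ := Projectivization.exists_smul_eq_mk_rep ℂ v hv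
  have hpos : 0 < Complex.normSq c := Complex.normSq_pos.2 c.ne_zero
  rw [hypSpace, Set.mem_ofPred_eq, ← hc, Units.smul_def, herm_smul_self, Complex.re_ofReal_mul,
    ← smul_eq_mul, smul_neg_iff_of_pos_left hpos]

lemma herm_rep_ne_zero {p q : ℙ ℂ (Fin (n + 1) → ℂ)} (hp : p ∈ sphere n) (hq : q ∈ sphere n)
    (hpq : p ≠ q) : herm p.rep q.rep ≠ 0 :=
  herm_ne_zero_of_linearIndependent hp hq (Projectivization.linearIndependent_pair_iff_ne.2 hpq)

lemma sphere_nontrivial (hn : 1 ≤ n) : (sphere n).Nontrivial := by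
  have hlast : Fin.last n ≠ 0 := by simpa [Fin.ext_iff] using Nat.one_le_iff_ne_zero.1 hn
  have hne (i : Fin (n + 1)) : (Pi.single i 1 : Fin (n + 1) → ℂ) ≠ 0 := by simp
  refine ⟨Projectivization.mk ℂ _ (hne 0), ?_, Projectivization.mk ℂ _ (hne (Fin.last n)), ?_, ?_⟩
  · simp [mk_mem_sphere_iff, herm_single_right, hlast]
  · simp [mk_mem_sphere_iff, herm_single_right, hlast.symm]
  · intro h
    obtain ⟨c, hc⟩ := (Projectivization.mk_eq_mk_iff' ℂ _ _ _ _).1 h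
    simpa [hlast.symm] using congrFun hc 0

lemma isClosed_sphere : IsClosed (sphere n) := by
  rw [← isQuotientMap_mk'.isClosed_preimage]
  have hpre : Projectivization.mk' ℂ ⁻¹' sphere n = {v | herm v.1 v.1 = 0} :=
    Set.ext fun v => mk_mem_sphere_iff v.2
  rw [hpre]
  exact isClosed_eq (continuous_herm_self.comp continuous_subtype_val) continuous_const

lemma isClosed_limitSet (Γ : Subgroup PGL(Fin (n + 1), ℂ)) (x : ℙ ℂ (Fin (n + 1) → ℂ)) :
    IsClosed (limitSet Γ x) :=
  isClosed_sphere.inter isClosed_closure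

end HyperbolicSpace

section Bisector

variable {n : ℕ}

lemma norm_smul_add_smul_comm_of_norm_eq {E : Type*} [NormedAddCommGroup E]
    [InnerProductSpace ℝ E] {x y : E} (h : ‖x‖ = ‖y‖) (r s : ℝ) :
    ‖r • x + s • y‖ = ‖s • x + r • y‖ := by
  rw [← sq_eq_sq₀ (norm_nonneg _) (norm_nonneg _), norm_add_sq_real, norm_add_sq_real]
  simp only [norm_smul, inner_smul_left, inner_smul_right, mul_pow, h]
  simp only [conj_trivial]
  ring

lemma exists_bisector_of_herm_neg {a b : Fin (n + 1) → ℂ} (ha : herm a a = 0)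
    (hb : herm b b = 0) {t : ℝ} (ht : 0 < t) (hab : herm a b = -(t : ℂ)) :
    ∃ p₀ ∈ hypSpace n, ∃ p₁ ∈ hypSpace n, p₀ ≠ p₁ ∧
      {z ∈ sphere n | ‖herm z.rep a‖ = ‖herm z.rep b‖} ⊆ bisector p₀ p₁ := by
  have hba : herm b a = -(t : ℂ) := by rw [← star_herm, hab]; simp
  have hexpand (r s r' s' : ℂ) :
      herm (r • a + s • b) (r' • a + s' • b) = -t * (r * star s' + s * star r') := by
    simp only [herm_add_left, herm_add_right, herm_smul_left, herm_smul_right, ha, hb, hab, hba]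
    ring
  set v₀ := (2 : ℂ) • a + (1 : ℂ) • b with hv₀
  set v₁ := (1 : ℂ) • a + (2 : ℂ) • b with hv₁
  have h₀ : herm v₀ v₀ = ((-(4 * t) : ℝ) : ℂ) := by rw [hexpand]; simp; ring
  have h₁ : herm v₁ v₁ = ((-(4 * t) : ℝ) : ℂ) := by rw [hexpand]; simp; ring
  have hne {v : Fin (n + 1) → ℂ} (hv : herm v v = ((-(4 * t) : ℝ) : ℂ)) : v ≠ 0 := by
    rintro rfl
    rw [show herm (0 : Fin (n + 1) → ℂ) 0 = 0 by simp [herm], eq_comm, Complex.ofReal_eq_zero] at hv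
    linarith
  refine ⟨.mk ℂ v₀ (hne h₀), ?_, .mk ℂ v₁ (hne h₁), ?_, ?_, ?_⟩
  · rw [mk_mem_hypSpace_iff, h₀, Complex.ofReal_re]; linarith
  · rw [mk_mem_hypSpace_iff, h₁, Complex.ofReal_re]; linarith
  · intro h
    obtain ⟨c, hc⟩ := (Projectivization.mk_eq_mk_iff' ℂ _ _ (hne h₀) (hne h₁)).1 h
    have hca : c * (2 * -t) = 1 * -t := by
      simpa [hv₀, hv₁, herm_add_left, herm_smul_left, ha, hba] using congrArg (herm · a) hc
    have hcb : c * (1 * -t) = 2 * -t := by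
      simpa [hv₀, hv₁, herm_add_left, herm_smul_left, hb, hab] using congrArg (herm · b) hc
    exact Complex.ofReal_ne_zero.2 ht.ne' (by linear_combination (2 * hcb - hca) / 3)
  · rintro z ⟨hz, hzab⟩
    refine ⟨.inr hz, v₀, v₁, hne h₀, hne h₁, rfl, rfl, h₀.trans h₁.symm, ?_⟩
    simpa [hv₀, hv₁, herm_add_right, herm_smul_right] using
      norm_smul_add_smul_comm_of_norm_eq hzab 2 1

lemma exists_bisector_of_sphere {ω ω' : ℙ ℂ (Fin (n + 1) → ℂ)} (hω : ω ∈ sphere n)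
    (hω' : ω' ∈ sphere n) (hne : ω ≠ ω') {c : ℝ} (hc : 0 < c) :
    ∃ p₀ ∈ hypSpace n, ∃ p₁ ∈ hypSpace n, p₀ ≠ p₁ ∧
      {z ∈ sphere n | ‖herm z.rep ω.rep‖ = c * ‖herm z.rep ω'.rep‖} ⊆ bisector p₀ p₁ := by
  have hisotropic : herm ω.rep ω.rep = 0 := hω
  have hisotropic' : herm ω'.rep ω'.rep = 0 := hω'
  obtain ⟨u, hu_norm, hu⟩ := Complex.exists_norm_eq_mul_self (herm ω.rep ω'.rep)
  have hpos : 0 < c * ‖herm ω.rep ω'.rep‖ :=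
    mul_pos hc (norm_pos_iff.2 (herm_rep_ne_zero hω hω' hne))
  set b := star (-(c * u)) • ω'.rep with hb
  have hb_isotropic : herm b b = 0 := by rw [hb, herm_smul_self, hisotropic', mul_zero]
  have hωb : herm ω.rep b = -((c * ‖herm ω.rep ω'.rep‖ : ℝ) : ℂ) := by
    rw [hb, herm_smul_right, star_star, Complex.ofReal_mul, hu]
    ring
  have hnorm_b (z : Fin (n + 1) → ℂ) : ‖herm z b‖ = c * ‖herm z ω'.rep‖ := by
    rw [hb, herm_smul_right, star_star, norm_mul, norm_neg, norm_mul, hu_norm, mul_one,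
      Complex.norm_real, Real.norm_of_nonneg hc.le]
  simpa only [hnorm_b] using exists_bisector_of_herm_neg hisotropic hb_isotropic hpos hωb

lemma nonempty_of_not_subset_bisector (hn : 1 ≤ n) {Λ : Set (ℙ ℂ (Fin (n + 1) → ℂ))}
    (hbis : ∀ p₀ ∈ hypSpace n, ∀ p₁ ∈ hypSpace n, p₀ ≠ p₁ → ¬ Λ ⊆ bisector p₀ p₁) :
    Λ.Nonempty := by
  obtain ⟨ω, hω, ω', hω', hne⟩ := sphere_nontrivial hn
  obtain ⟨p₀, hp₀, p₁, hp₁, hp, -⟩ := exists_bisector_of_sphere hω hω' hne one_pos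
  rw [Set.nonempty_iff_ne_empty]
  rintro rfl
  exact hbis p₀ hp₀ p₁ hp₁ hp (Set.empty_subset _)

end Bisector

section Polar

variable {n : ℕ} {Λ : Set (ℙ ℂ (Fin (n + 1) → ℂ))} {p p' ω ω' : ℙ ℂ (Fin (n + 1) → ℂ)}

lemma polar_rep_apply_ne_zero_iff {v : Fin (n + 1) → ℂ} :
    (polar p).rep v ≠ 0 ↔ herm v p.rep ≠ 0 := by
  obtain ⟨c, hc⟩ :=
    Projectivization.exists_smul_eq_mk_rep ℂ (hermForm p.rep) (hermForm_ne_zero p.rep_nonzero)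
  rw [polar, ← hc]
  simp [Units.smul_def, hermForm]

lemma herm_rep_ne_zero_of_mem_hyperplaneCompl (hω : ω ∈ hyperplaneCompl (polar '' Λ))
    (hp : p ∈ Λ) : herm ω.rep p.rep ≠ 0 :=
  polar_rep_apply_ne_zero_iff.1 (hω _ ⟨p, hp, rfl⟩)

lemma sphere_diff_subset_hyperplaneCompl (hΛ : Λ ⊆ sphere n) :
    sphere n \ Λ ⊆ hyperplaneCompl (polar '' Λ) := by
  rintro ω ⟨hω, hωΛ⟩ _ ⟨p, hp, rfl⟩
  exact polar_rep_apply_ne_zero_iff.2 (herm_rep_ne_zero hω (hΛ hp) fun h => hωΛ (h ▸ hp))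

/-- The quantity `|⟨p, ω⟩| / |⟨p, ω'⟩|`, through which the moduli of cross-ratios of polar
hyperplanes factor. It does not depend on the lift of `p`, but it does depend on the chosen lifts
`ω.rep` and `ω'.rep`. -/
noncomputable def hermRatio (ω ω' p : ℙ ℂ (Fin (n + 1) → ℂ)) : ℝ :=
  ‖herm p.rep ω.rep / herm p.rep ω'.rep‖

lemma hermRatio_pos (hω : ω ∈ hyperplaneCompl (polar '' Λ))
    (hω' : ω' ∈ hyperplaneCompl (polar '' Λ)) (hp : p ∈ Λ) : 0 < hermRatio ω ω' p := by
  have h := herm_ne_zero_comm.1 (herm_rep_ne_zero_of_mem_hyperplaneCompl hω hp)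
  have h' := herm_ne_zero_comm.1 (herm_rep_ne_zero_of_mem_hyperplaneCompl hω' hp)
  exact norm_pos_iff.2 (div_ne_zero h h')

lemma norm_crossRatio_polar (hp : p ∈ Λ) (hp' : p' ∈ Λ) (hω : ω ∈ hyperplaneCompl (polar '' Λ))
    (hω' : ω' ∈ hyperplaneCompl (polar '' Λ)) :
    ‖crossRatio (polar p) (polar p') ω ω'‖ = hermRatio ω ω' p * hermRatio ω' ω p' := by
  have hlift : crossRatio (polar p) (polar p') ω ω' =
      (herm ω.rep p.rep * herm ω'.rep p'.rep) / (herm ω'.rep p.rep * herm ω.rep p'.rep) := by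
    conv_lhs => rw [← ω.mk_rep, ← ω'.mk_rep]
    exact crossRatio_mk _ _ _ _ _ _ _ _ (herm_rep_ne_zero_of_mem_hyperplaneCompl hω hp)
      (herm_rep_ne_zero_of_mem_hyperplaneCompl hω' hp)
      (herm_rep_ne_zero_of_mem_hyperplaneCompl hω hp')
      (herm_rep_ne_zero_of_mem_hyperplaneCompl hω' hp')
  rw [hlift, mul_div_mul_comm, norm_mul, hermRatio, hermRatio]
  simp only [norm_div, norm_herm_comm p.rep, norm_herm_comm p'.rep]

lemma crossRatioModuli_polar_eq_mul (hω : ω ∈ hyperplaneCompl (polar '' Λ))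
    (hω' : ω' ∈ hyperplaneCompl (polar '' Λ)) :
    crossRatioModuli (polar '' Λ) ω ω' = hermRatio ω ω' '' Λ * hermRatio ω' ω '' Λ := by
  ext r
  constructor
  · rintro ⟨_, ⟨p, hp, rfl⟩, _, ⟨p', hp', rfl⟩, rfl⟩
    rw [norm_crossRatio_polar hp hp' hω hω']
    exact Set.mul_mem_mul ⟨p, hp, rfl⟩ ⟨p', hp', rfl⟩
  · rintro ⟨_, ⟨p, hp, rfl⟩, _, ⟨p', hp', rfl⟩, rfl⟩
    exact ⟨_, ⟨p, hp, rfl⟩, _, ⟨p', hp', rfl⟩, (norm_crossRatio_polar hp hp' hω hω').symm⟩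

lemma continuousOn_hermRatio (ω : ℙ ℂ (Fin (n + 1) → ℂ))
    (hω' : ω' ∈ hyperplaneCompl (polar '' Λ)) : ContinuousOn (hermRatio ω ω') Λ := by
  have hform (v : Fin (n + 1) → ℂ) : Continuous (hermForm v) :=
    (hermForm v).continuous_of_finiteDimensional
  have hcont := continuousOn_div_rep (hform ω.rep) (hform ω'.rep)
  exact hcont.norm.mono fun p hp =>
    herm_ne_zero_comm.1 (herm_rep_ne_zero_of_mem_hyperplaneCompl hω' hp)

lemma isCompact_crossRatioModuli_polar (hΛ : IsClosed Λ) (hω : ω ∈ hyperplaneCompl (polar '' Λ))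
    (hω' : ω' ∈ hyperplaneCompl (polar '' Λ)) :
    IsCompact (crossRatioModuli (polar '' Λ) ω ω') := by
  rw [crossRatioModuli_polar_eq_mul hω hω']
  exact (hΛ.isCompact.image_of_continuousOn (continuousOn_hermRatio ω hω')).mul
    (hΛ.isCompact.image_of_continuousOn (continuousOn_hermRatio ω' hω))

lemma exists_bisector_of_norm_crossRatio_eq_one (hΛ : Λ ⊆ sphere n) (hne : Λ.Nonempty)
    (hω : ω ∈ sphere n \ Λ) (hω' : ω' ∈ sphere n \ Λ) (hωω' : ω ≠ ω')
    (h : ∀ φ ∈ polar '' Λ, ∀ φ' ∈ polar '' Λ, ‖crossRatio φ φ' ω ω'‖ = 1) :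
    ∃ p₀ ∈ hypSpace n, ∃ p₁ ∈ hypSpace n, p₀ ≠ p₁ ∧ Λ ⊆ bisector p₀ p₁ := by
  obtain ⟨q, hq⟩ := hne
  have hωc := sphere_diff_subset_hyperplaneCompl hΛ hω
  have hωc' := sphere_diff_subset_hyperplaneCompl hΛ hω'
  have hpos : 0 < hermRatio ω' ω q := hermRatio_pos hωc' hωc hq
  obtain ⟨p₀, hp₀, p₁, hp₁, hp, hsub⟩ :=
    exists_bisector_of_sphere hω.1 hω'.1 hωω' (inv_pos.2 hpos)
  refine ⟨p₀, hp₀, p₁, hp₁, hp, fun p hpΛ => hsub ⟨hΛ hpΛ, ?_⟩⟩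
  have hconst : hermRatio ω ω' p = (hermRatio ω' ω q)⁻¹ := by
    apply eq_inv_of_mul_eq_one_left
    rw [← norm_crossRatio_polar hpΛ hq hωc hωc']
    exact h _ ⟨p, hpΛ, rfl⟩ _ ⟨q, hq, rfl⟩
  have hpω' : herm p.rep ω'.rep ≠ 0 :=
    herm_ne_zero_comm.1 (herm_rep_ne_zero_of_mem_hyperplaneCompl hωc' hpΛ)
  rwa [hermRatio, norm_div, div_eq_iff (norm_ne_zero_iff.2 hpω')] at hconst

end Polar

end GenHilbert

open GenHilbert in
theorem mainTheorem12_general (n : ℕ) (hn : 1 ≤ n) (Λ : Set (ℙ ℂ (Fin (n + 1) → ℂ)))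
    (hΛ : Λ ⊆ sphere n) (hclosed : IsClosed Λ)
    (hbis : ∀ p₀ ∈ hypSpace n, ∀ p₁ ∈ hypSpace n, p₀ ≠ p₁ → ¬ Λ ⊆ bisector p₀ p₁) :
    (∀ ω ∈ sphere n \ Λ, ∀ ω' ∈ sphere n \ Λ, ∃ r : ℝ,
      IsGreatest (crossRatioModuli (polar '' Λ) ω ω') r) ∧
    ∃ m : MetricSpace ↥(sphere n \ Λ), ∀ ω ω' : ↥(sphere n \ Λ),
      m.dist ω ω' = hilbertDist (polar '' Λ) ω ω' := by
  have hne : Λ.Nonempty := nonempty_of_not_subset_bisector hn hbis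
  have hΩ := sphere_diff_subset_hyperplaneCompl hΛ
  have hsep : ∀ ω ∈ sphere n \ Λ, ∀ ω' ∈ sphere n \ Λ,
      (∀ φ ∈ polar '' Λ, ∀ φ' ∈ polar '' Λ, ‖crossRatio φ φ' ω ω'‖ = 1) → ω = ω' := by
    intro ω hω ω' hω' h
    by_contra hωω'
    obtain ⟨p₀, hp₀, p₁, hp₁, hp, hsub⟩ :=
      exists_bisector_of_norm_crossRatio_eq_one hΛ hne hω hω' hωω' h
    exact hbis p₀ hp₀ p₁ hp₁ hp hsub
  refine ⟨fun ω hω ω' hω' => ?_, hilbertMetricSpace (polar '' Λ) _ (hne.image polar) hΩ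
    (fun _ hω _ hω' => (isCompact_crossRatioModuli_polar hclosed hω hω').bddAbove) hsep,
    fun _ _ => rfl⟩
  exact (isCompact_crossRatioModuli_polar hclosed (hΩ hω) (hΩ hω')).exists_isGreatest
    ⟨1, one_mem_crossRatioModuli (hne.image polar) (hΩ hω) (hΩ hω')⟩

theorem mainTheorem12 (n : ℕ) (hn : 1 ≤ n)
    (Γ : Subgroup PGL(Fin (n + 1), ℂ)) (hΓ : Γ ≤ GenHilbert.PU n) (hdisc : DiscreteTopology Γ)
    (x : ℙ ℂ (Fin (n + 1) → ℂ)) (hx : x ∈ GenHilbert.hypSpace n)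
    (Λ : Set (ℙ ℂ (Fin (n + 1) → ℂ))) (hΛ : Λ = GenHilbert.limitSet Γ x)
    (Ω : Set (ℙ ℂ (Fin (n + 1) → ℂ))) (hΩ : Ω = GenHilbert.sphere n \ Λ)
    (hbis : ∀ p₀ ∈ GenHilbert.hypSpace n, ∀ p₁ ∈ GenHilbert.hypSpace n, p₀ ≠ p₁ →
      ¬ Λ ⊆ GenHilbert.bisector p₀ p₁) :
    (∀ ω ∈ Ω, ∀ ω' ∈ Ω, ∃ r : ℝ,
      IsGreatest (GenHilbert.crossRatioModuli (GenHilbert.polar '' Λ) ω ω') r) ∧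
    ∃ m : MetricSpace Ω, ∀ ω ω' : Ω,
      m.dist ω ω' = GenHilbert.hilbertDist (GenHilbert.polar '' Λ) ω ω' := by
  subst hΩ
  exact mainTheorem12_general n hn Λ (hΛ ▸ Set.inter_subset_left)
    (hΛ ▸ GenHilbert.isClosed_limitSet Γ x) hbis
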